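/- Let $R$ be a unital ring, not necessarily commutative, with group of invertible elements $\mathrm{GL}(1,R)$. Consider the partial maps $T_a: x\mapsto x+a$ ($a\in R$) and $M_{r,s}: x\mapsto rxs$ ($r,s\in \mathrm{GL}(1,R)$), defined on all of $R$, and $J: x\mapsto x^{-1}$, defined on $\mathrm{GL}(1,R)$. A string is a finite formal product of such maps; it acts as their composition, and is defined at those $x\in R$ at which every successive step is defined. Put $U_0=\mathrm{GL}(1,R)$ and, for $a_1,\dots,a_i\in R$, $$U_i(a_1,\dots,a_i)=\bigl(\mathrm{GL}(1,R)\cap (U_{i-1}(a_1,\dots,a_{i-1})-a_i)\bigr)^{-1},$$ where $X^{-1}$ denotes the set of inverses of the elements of $X$. Say that $\mathcal G(R)$ exists if all the sets $U_n(a_1,\dots,a_n)$ are nonempty and any two strings that are both defined on some $U_n(a_1,\dots,a_n)$ and agree there agree on every set on which both are defined. In that case, equality on the intersection of the domains is an equivalence relation on strings, and the equivalence classes form a group $\mathcal G(R)$ under stringing together (composition). Let $\mathrm E(2,R)$ be the subgroup of $\mathrm{GL}(2,R)$ generated by all matrices $\begin{pmatrix}1&a\\0&1\end{pmatrix}$ ($a\in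 R$), $\begin{pmatrix}r&0\\0&s\end{pmatrix}$ ($r,s\in\mathrm{GL}(1,R)$) and $\begin{pmatrix}0&1\\1&0\end{pmatrix}$. Let $\mathrm{PE}(2,R)$ be the quotient of $\mathrm E(2,R)$ by the group of scalar matrices $\lambda I$ with $\lambda$ an invertible element of the centre of $R$, and let $[\,\cdot\,]$ denote classes in $\mathrm{PE}(2,R)$. Suppose that $\mathcal G(R)$ exists. Then the assignment $$T_a\mapsto\left[\begin{pmatrix}1&a\\0&1\end{pmatrix}\right],\qquad M_{r,s}\mapsto\left[\begin{pmatrix}r&0\\0&s^{-1}\end{pmatrix}\right],\qquad J\mapsto\left[\begin{pmatrix}0&1\\1&0\end{pmatrix}\right]$$ for all $a\in R$ and $r,s\in \mathrm{GL}(1,R)$ extends to an isomorphism of groups $\mathcal G(R)\to \mathrm{PE}(2,R)$. -/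

import Mathlib

namespace FLT

/-! ### Strings of partially defined maps -/

/-- The generating partial maps: translations `T a`, two-sided multiplications `M r s`
by invertible elements, and the inversion `J`. -/
inductive Gen (R : Type*) [Ring R] where
  | T (a : R) : Gen R
  | M (r s : Rˣ) : Gen R
  | J : Gen R

/-- The partial map `R → R` attached to a generator:
`T a : x ↦ x + a` and `M r s : x ↦ r x s` on all of `R`, and `J : x ↦ x⁻¹` on the
invertible elements of `R`. -/
noncomputable def Gen.toPFun {R : Type*} [Ring R] : Gen R → (R →. R)
  | .T a => ((fun x => x + a : R → R) : R →. R)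
  | .M r s => ((fun x => (r : R) * x * (s : R) : R → R) : R →. R)
  | .J => fun x => ⟨IsUnit x, fun h => ((h.unit⁻¹ : Rˣ) : R)⟩

/-- The partial map of a formal string, composed like functions (the last letter acts first)
and defined wherever all the successive steps are defined. -/
noncomputable def eval {R : Type*} [Ring R] : List (Gen R) → (R →. R)
  | [] => PFun.id R
  | g :: w => g.toPFun.comp (eval w)

/-- Two strings agree on a set on which both are defined. -/
def AgreeOn {R : Type*} [Ring R] (w w' : List (Gen R)) (S : Set R) : Prop :=
  S ⊆ (eval w).Dom ∧ S ⊆ (eval w').Dom ∧ ∀ x ∈ S, eval w x = eval w' x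

/-- The basic domains `U₀ = GL(1,R)` and
`Uᵢ(a₁,…,aᵢ) = (GL(1,R) ∩ (Uᵢ₋₁(a₁,…,aᵢ₋₁) - aᵢ))⁻¹`; the list is `[aᵢ, …, a₁]`. -/
def U {R : Type*} [Ring R] : List R → Set R
  | [] => {z | IsUnit z}
  | b :: a => {z | ∃ u : Rˣ, (u : R) + b ∈ U a ∧ z = ((u⁻¹ : Rˣ) : R)}

/-- The condition under which the group of fractional linear transformations of `R` exists:
the basic domains are nonempty, and two strings that are defined and agree on one basic domain
agree on every set on which they are both defined. -/
structure GroupExists (R : Type*) [Ring R] : Prop where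
  nonempty : ∀ a : List R, (U a).Nonempty
  agree : ∀ (w w' : List (Gen R)) (a : List R), AgreeOn w w' (U a) →
    ∀ S : Set R, S ⊆ (eval w).Dom → S ⊆ (eval w').Dom → AgreeOn w w' S

/-- Equivalence of strings: equality on the intersection of their domains. -/
def Equivalent {R : Type*} [Ring R] (w w' : List (Gen R)) : Prop :=
  AgreeOn w w' ((eval w).Dom ∩ (eval w').Dom)

/-- The formal inverse of a generator. -/
def Gen.inv {R : Type*} [Ring R] : Gen R → Gen R
  | .T a => .T (-a)
  | .M r s => .M r⁻¹ s⁻¹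
  | .J => .J

/-- The formal inverse of a string. -/
def invString {R : Type*} [Ring R] (w : List (Gen R)) : List (Gen R) :=
  (w.map Gen.inv).reverse

/-! ### The group structure -/

section facts

variable {R : Type*} [Ring R]

theorem mem_eval_nil {x y : R} : y ∈ eval ([] : List (Gen R)) x ↔ y = x := by
  simp [eval, PFun.id]

theorem mem_eval_cons {g : Gen R} {w : List (Gen R)} {x y : R} :
    y ∈ eval (g :: w) x ↔ ∃ z ∈ eval w x, y ∈ g.toPFun z := by
  rw [eval, PFun.comp_apply]
  exact Part.mem_bind_iff

theorem mem_eval_append {w v : List (Gen R)} {x y : R} :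
    y ∈ eval (w ++ v) x ↔ ∃ z ∈ eval v x, y ∈ eval w z := by
  induction w generalizing y with
  | nil => simp [mem_eval_nil]
  | cons g w ih =>
    simp only [List.cons_append, mem_eval_cons, ih]
    constructor
    · rintro ⟨z, ⟨t, ht, htz⟩, hz⟩
      exact ⟨t, ht, z, htz, hz⟩
    · rintro ⟨t, ht, z, htz, hz⟩
      exact ⟨z, ⟨t, ht, htz⟩, hz⟩

theorem mem_T {a x y : R} : y ∈ (Gen.T a).toPFun x ↔ y = x + a := by
  simp [Gen.toPFun, PFun.coe_val]

theorem mem_M {r s : Rˣ} {x y : R} : y ∈ (Gen.M r s).toPFun x ↔ y = r * x * s := by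
  simp [Gen.toPFun, PFun.coe_val]

theorem mem_J {x y : R} :
    y ∈ (Gen.J : Gen R).toPFun x ↔ ∃ u : Rˣ, x = u ∧ y = ((u⁻¹ : Rˣ) : R) := by
  constructor
  · rintro ⟨h, rfl⟩
    exact ⟨IsUnit.unit h, rfl, rfl⟩
  · rintro ⟨u, rfl, rfl⟩
    refine ⟨u.isUnit, ?_⟩
    have : u.isUnit.unit = u := Units.ext rfl
    exact congrArg (fun v : Rˣ => ((v⁻¹ : Rˣ) : R)) this

theorem mem_inv {g : Gen R} {x y : R} (h : y ∈ g.toPFun x) : x ∈ g.inv.toPFun y := by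
  cases g with
  | T a => rw [mem_T] at h; simp [Gen.inv, mem_T, h]
  | M r s => rw [mem_M] at h; simp [Gen.inv, mem_M, h, mul_assoc]
  | J =>
    obtain ⟨u, rfl, rfl⟩ := mem_J.1 h
    exact mem_J.2 ⟨u⁻¹, rfl, by simp⟩

theorem mem_eval_invString {w : List (Gen R)} {x y : R} (h : y ∈ eval w x) :
    x ∈ eval (invString w) y := by
  induction w generalizing y with
  | nil => rw [mem_eval_nil] at h; simp [invString, mem_eval_nil, h]
  | cons g w ih =>
    obtain ⟨z, hz, hy⟩ := mem_eval_cons.1 h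
    have : invString (g :: w) = invString w ++ [g.inv] := by simp [invString]
    rw [this, mem_eval_append]
    exact ⟨z, mem_eval_cons.2 ⟨y, mem_eval_nil.2 rfl, mem_inv hy⟩, ih hz⟩

theorem invString_invString (w : List (Gen R)) : invString (invString w) = w := by
  have : (Gen.inv ∘ Gen.inv : Gen R → Gen R) = id := by
    funext g
    cases g <;> simp [Gen.inv]
  simp [invString, this]

theorem mem_U_cons {b z : R} {a : List R} :
    z ∈ U (b :: a) ↔ ∃ u : Rˣ, (u : R) + b ∈ U a ∧ z = ((u⁻¹ : Rˣ) : R) := Iff.rfl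

theorem exists_U_M (r s : Rˣ) (a : List R) :
    ∃ a' : List R, ∀ x ∈ U a', (r : R) * x * s ∈ U a := by
  induction a generalizing r s with
  | nil =>
    refine ⟨[], ?_⟩
    rintro _ ⟨u, rfl⟩
    exact ⟨r * u * s, by simp⟩
  | cons b a ih =>
    obtain ⟨a', h⟩ := ih s⁻¹ r⁻¹
    refine ⟨(s * b * r) :: a', ?_⟩
    rintro _ ⟨u, hu, rfl⟩
    refine ⟨s⁻¹ * u * r⁻¹, ?_, by simp [mul_assoc]⟩
    convert h _ hu using 1
    simp [mul_add, add_mul, mul_assoc]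

theorem exists_U_gen (g : Gen R) (a : List R) :
    ∃ a' : List R, ∀ x ∈ U a', ∃ y ∈ g.toPFun x, y ∈ U a := by
  cases g with
  | T b =>
    refine ⟨0 :: b :: a, ?_⟩
    rintro _ ⟨u, ⟨v, hv, huv⟩, rfl⟩
    refine ⟨_, mem_T.2 rfl, ?_⟩
    have : u⁻¹ = v := by
      rw [add_zero] at huv
      rw [Units.ext huv, inv_inv]
    rwa [this]
  | M r s =>
    obtain ⟨a', h⟩ := exists_U_M r s a
    exact ⟨a', fun x hx => ⟨_, mem_M.2 rfl, h x hx⟩⟩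
  | J =>
    refine ⟨0 :: a, ?_⟩
    rintro _ ⟨u, hu, rfl⟩
    exact ⟨u, mem_J.2 ⟨u⁻¹, rfl, by simp⟩, by simpa using hu⟩

theorem exists_U_eval (w : List (Gen R)) (a : List R) :
    ∃ a' : List R, ∀ x ∈ U a', ∃ y ∈ eval w x, y ∈ U a := by
  induction w generalizing a with
  | nil => exact ⟨a, fun x hx => ⟨x, mem_eval_nil.2 rfl, hx⟩⟩
  | cons g w ih =>
    obtain ⟨a₁, h₁⟩ := exists_U_gen g a
    obtain ⟨a', h'⟩ := ih a₁
    refine ⟨a', fun x hx => ?_⟩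
    obtain ⟨z, hz, hzU⟩ := h' x hx
    obtain ⟨y, hy, hyU⟩ := h₁ z hzU
    exact ⟨y, mem_eval_cons.2 ⟨z, hz, hy⟩, hyU⟩

/-- Finitely many strings have a basic domain on which all of them are defined. -/
theorem exists_U_subset_dom₃ (w w' w'' : List (Gen R)) :
    ∃ a : List R, U a ⊆ (eval w).Dom ∧ U a ⊆ (eval w').Dom ∧ U a ⊆ (eval w'').Dom := by
  obtain ⟨a, h⟩ := exists_U_eval (w'' ++ (invString w' ++ (w' ++ (invString w ++ w)))) []
  have key : ∀ x ∈ U a, x ∈ (eval w).Dom ∧ x ∈ (eval w').Dom ∧ x ∈ (eval w'').Dom := by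
    intro x hx
    obtain ⟨y, hy, -⟩ := h x hx
    obtain ⟨x₃, h₃, h₃'⟩ := mem_eval_append.1 hy
    obtain ⟨y₂, h₂, h₂'⟩ := mem_eval_append.1 h₃
    obtain ⟨x₁, h₁, h₁'⟩ := mem_eval_append.1 h₂
    obtain ⟨y₀, h₀, h₀'⟩ := mem_eval_append.1 h₁
    have e₁ : x₁ = x := Part.mem_unique h₀' (mem_eval_invString h₀)
    subst e₁
    have e₃ : x₃ = x₁ := Part.mem_unique h₂' (mem_eval_invString h₁')
    subst e₃
    exact ⟨(PFun.mem_dom _ _).2 ⟨_, h₀⟩, (PFun.mem_dom _ _).2 ⟨_, h₁'⟩,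
      (PFun.mem_dom _ _).2 ⟨_, h₃'⟩⟩
  exact ⟨a, fun x hx => (key x hx).1, fun x hx => (key x hx).2.1, fun x hx => (key x hx).2.2⟩

theorem equivalent_iff {w w' : List (Gen R)} :
    Equivalent w w' ↔ ∀ x, ∀ y ∈ eval w x, ∀ y' ∈ eval w' x, y = y' := by
  constructor
  · intro h x y hy y' hy'
    have := h.2.2 x ⟨(PFun.mem_dom _ _).2 ⟨_, hy⟩, (PFun.mem_dom _ _).2 ⟨_, hy'⟩⟩
    rw [← this] at hy'
    exact Part.mem_unique hy hy'
  · refine fun h => ⟨Set.inter_subset_left, Set.inter_subset_right, ?_⟩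
    rintro x ⟨hx, hx'⟩
    obtain ⟨y, hy⟩ := (PFun.mem_dom _ _).1 hx
    obtain ⟨y', hy'⟩ := (PFun.mem_dom _ _).1 hx'
    have := h x y hy y' hy'
    subst this
    rw [Part.eq_some_iff.2 hy, Part.eq_some_iff.2 hy']

theorem Equivalent.refl (w : List (Gen R)) : Equivalent w w :=
  equivalent_iff.2 fun _ _ hy _ hy' => Part.mem_unique hy hy'

theorem Equivalent.symm {w w' : List (Gen R)} (h : Equivalent w w') : Equivalent w' w :=
  equivalent_iff.2 fun x y hy y' hy' => (equivalent_iff.1 h x y' hy' y hy).symm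

theorem Equivalent.trans (hR : GroupExists R) {w w' w'' : List (Gen R)}
    (h : Equivalent w w') (h' : Equivalent w' w'') : Equivalent w w'' := by
  obtain ⟨a, h₁, h₂, h₃⟩ := exists_U_subset_dom₃ w w' w''
  refine hR.agree w w'' a ⟨h₁, h₃, fun x hx => ?_⟩ _ Set.inter_subset_left Set.inter_subset_right
  exact (h.2.2 x ⟨h₁ hx, h₂ hx⟩).trans (h'.2.2 x ⟨h₂ hx, h₃ hx⟩)

theorem Equivalent.append {w w' v v' : List (Gen R)}
    (h : Equivalent w w') (h' : Equivalent v v') : Equivalent (w ++ v) (w' ++ v') := by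
  refine equivalent_iff.2 fun x y hy y' hy' => ?_
  obtain ⟨z, hz, hzy⟩ := mem_eval_append.1 hy
  obtain ⟨z', hz', hzy'⟩ := mem_eval_append.1 hy'
  have := equivalent_iff.1 h' x z hz z' hz'
  subst this
  exact equivalent_iff.1 h z y hzy y' hzy'

theorem equivalent_invString_append (w : List (Gen R)) : Equivalent (invString w ++ w) [] := by
  refine equivalent_iff.2 fun x y hy y' hy' => ?_
  obtain ⟨z, hz, hzy⟩ := mem_eval_append.1 hy
  rw [mem_eval_nil] at hy'
  subst hy'
  exact Part.mem_unique hzy (mem_eval_invString hz)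

theorem equivalent_append_invString (w : List (Gen R)) : Equivalent (w ++ invString w) [] := by
  simpa [invString_invString] using equivalent_invString_append (invString w)

theorem Equivalent.invString (hR : GroupExists R) {w w' : List (Gen R)}
    (h : Equivalent w w') : Equivalent (FLT.invString w) (FLT.invString w') := by
  have h₁ : Equivalent (FLT.invString w) (FLT.invString w ++ (w' ++ FLT.invString w')) := by
    simpa using (Equivalent.refl (FLT.invString w)).append (equivalent_append_invString w').symm
  have h₂ : Equivalent (FLT.invString w ++ (w' ++ FLT.invString w'))
      (FLT.invString w ++ (w ++ FLT.invString w')) :=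
    (Equivalent.refl _).append (h.symm.append (Equivalent.refl _))
  have h₃ : Equivalent (FLT.invString w ++ (w ++ FLT.invString w')) (FLT.invString w') := by
    simpa using (equivalent_invString_append w).append (Equivalent.refl (FLT.invString w'))
  exact (h₁.trans hR h₂).trans hR h₃

end facts

/-- Equivalence of strings as a setoid, when the group exists. -/
def stringSetoid {R : Type*} [Ring R] (hR : GroupExists R) : Setoid (List (Gen R)) where
  r := Equivalent
  iseqv := ⟨Equivalent.refl, Equivalent.symm, Equivalent.trans hR⟩

/-- The group of fractional linear transformations: equivalence classes of strings. -/
def G {R : Type*} [Ring R] (hR : GroupExists R) : Type _ := Quotient (stringSetoid hR)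

/-- The class of a string. -/
def G.mk {R : Type*} [Ring R] (hR : GroupExists R) (w : List (Gen R)) : G hR :=
  Quotient.mk (stringSetoid hR) w

/-- The product is induced by stringing together, that is, by composition. -/
instance {R : Type*} [Ring R] (hR : GroupExists R) : Group (G hR) where
  mul := Quotient.map₂ (· ++ ·) fun _ _ h _ _ h' => Equivalent.append h h'
  one := G.mk hR []
  inv := Quotient.map invString fun _ _ h => Equivalent.invString hR h
  mul_assoc := by
    rintro ⟨x⟩ ⟨y⟩ ⟨z⟩
    exact congrArg (G.mk hR) (List.append_assoc x y z)
  one_mul := by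
    rintro ⟨x⟩
    exact congrArg (G.mk hR) (List.nil_append x)
  mul_one := by
    rintro ⟨x⟩
    exact congrArg (G.mk hR) (List.append_nil x)
  inv_mul_cancel := by
    rintro ⟨x⟩
    exact Quotient.sound (s := stringSetoid hR) (equivalent_invString_append x)

/-! ### The projective elementary group -/

section matrices

variable {R : Type*} [Ring R]

/-- The matrix `[[1, a], [0, 1]]` in `GL(2,R)`. -/
def t (a : R) : (Matrix (Fin 2) (Fin 2) R)ˣ where
  val := !![1, a; 0, 1]
  inv := !![1, -a; 0, 1]
  val_inv := by simp [Matrix.one_fin_two]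
  inv_val := by simp [Matrix.one_fin_two]

/-- The matrix `diag(r, s)` in `GL(2,R)`. -/
def m (r s : Rˣ) : (Matrix (Fin 2) (Fin 2) R)ˣ where
  val := !![(r : R), 0; 0, (s : R)]
  inv := !![((r⁻¹ : Rˣ) : R), 0; 0, ((s⁻¹ : Rˣ) : R)]
  val_inv := by simp [Matrix.one_fin_two]
  inv_val := by simp [Matrix.one_fin_two]

/-- The matrix `[[0, 1], [1, 0]]` in `GL(2,R)`. -/
def j : (Matrix (Fin 2) (Fin 2) R)ˣ where
  val := !![0, 1; 1, 0]
  inv := !![0, 1; 1, 0]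
  val_inv := by simp [Matrix.one_fin_two]
  inv_val := by simp [Matrix.one_fin_two]

end matrices

/-- `E(2,R)`, the subgroup of `GL(2,R)` generated by all `t a`, `m r s` and `j`. -/
def E2 (R : Type*) [Ring R] : Subgroup (Matrix (Fin 2) (Fin 2) R)ˣ :=
  Subgroup.closure
    (Set.range t ∪ Set.range (fun p : Rˣ × Rˣ => m p.1 p.2) ∪ {j})

/-- The scalar matrices in `E(2,R)` whose scalar is an invertible element of the centre of `R`. -/
def centralScalars (R : Type*) [Ring R] : Subgroup (E2 R) :=
  (Units.map ((Matrix.scalar (Fin 2)).comp (Subring.center R).subtype).toMonoidHom).range.subgroupOf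
    (E2 R)

instance (R : Type*) [Ring R] : (centralScalars R).Normal where
  conj_mem := by
    rintro x ⟨z, hz⟩ g
    refine ⟨z, ?_⟩
    have comm : ∀ A : (Matrix (Fin 2) (Fin 2) R)ˣ, A * (x : (Matrix (Fin 2) (Fin 2) R)ˣ)
        = (x : (Matrix (Fin 2) (Fin 2) R)ˣ) * A := by
      intro A
      have hz' : (x : (Matrix (Fin 2) (Fin 2) R)ˣ) = _ := hz.symm
      rw [hz']
      ext i k
      simpa using ((Subring.mem_center_iff.1 (z : Subring.center R).2)
        ((A : Matrix (Fin 2) (Fin 2) R) i k))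
    rw [hz]
    simp [comm]

/-- `PE(2,R)`, the projective elementary group. -/
abbrev PE2 (R : Type*) [Ring R] : Type _ := E2 R ⧸ centralScalars R

/-- The class in `PE(2,R)` of an element of `E(2,R)`. -/
def PE2.mk {R : Type*} [Ring R] (g : (Matrix (Fin 2) (Fin 2) R)ˣ) (hg : g ∈ E2 R) : PE2 R :=
  QuotientGroup.mk (s := centralScalars R) ⟨g, hg⟩

theorem t_mem {R : Type*} [Ring R] (a : R) : t a ∈ E2 R :=
  Subgroup.subset_closure (Or.inl (Or.inl ⟨a, rfl⟩))

theorem m_mem {R : Type*} [Ring R] (r s : Rˣ) : m r s ∈ E2 R :=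
  Subgroup.subset_closure (Or.inl (Or.inr ⟨(r, s), rfl⟩))

theorem j_mem {R : Type*} [Ring R] : (j : (Matrix (Fin 2) (Fin 2) R)ˣ) ∈ E2 R :=
  Subgroup.subset_closure (Or.inr rfl)

end FLT

namespace FLT

/-! ### Strings and their matrices. -/

variable {R : Type*} [Ring R]

/-! Matrices act on columns: if a string sends `x` to `y`, its matrix sends `(x, 1)` to `(y * u, u)`
for a unit `u` (`exists_unit_of_mem_eval`). Hence the matrix determines the string up to
equivalence, and a central scalar matrix forces the identity. This gives injectivity; surjectivity
holds because the generators of `E(2,R)` come from letters.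

Well-definedness is the main point: a string equivalent to the empty one must have a central scalar
matrix (`toE2_mem_centralScalars`). Such a string fixes some point, which a translation moves to 0.
The matrix is then lower triangular with invertible diagonal, and conjugation by `J` makes it the
matrix of an everywhere defined map `x ↦ d x e + c`. That map is the identity on all of `R`, so `c =
0`, `d = e⁻¹`, and `e` is central. -/

/-- The element of `E(2,R)` attached to a generator. -/
def Gen.toE2 : Gen R → E2 R
  | .T a => ⟨t a, t_mem a⟩
  | .M r s => ⟨m r s⁻¹, m_mem r s⁻¹⟩
  | .J => ⟨j, j_mem⟩

/-- The element of `E(2,R)` attached to a string. -/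
def toE2 (w : List (Gen R)) : E2 R := (w.map Gen.toE2).prod

/-- The matrix attached to a string. -/
def mat (w : List (Gen R)) : Matrix (Fin 2) (Fin 2) R :=
  ((toE2 w : (Matrix (Fin 2) (Fin 2) R)ˣ) : Matrix (Fin 2) (Fin 2) R)

theorem toE2_nil : toE2 ([] : List (Gen R)) = 1 := rfl

theorem toE2_cons (g : Gen R) (w : List (Gen R)) : toE2 (g :: w) = g.toE2 * toE2 w := by
  simp [toE2]

theorem toE2_append (w v : List (Gen R)) : toE2 (w ++ v) = toE2 w * toE2 v := by
  simp [toE2]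

theorem mat_nil : mat ([] : List (Gen R)) = 1 := rfl

theorem mat_cons_T (a : R) (w : List (Gen R)) :
    mat (.T a :: w) = !![1, a; 0, 1] * mat w := by
  simp [mat, toE2_cons, Gen.toE2, t]

theorem mat_cons_M (r s : Rˣ) (w : List (Gen R)) :
    mat (.M r s :: w) = !![(r : R), 0; 0, ((s⁻¹ : Rˣ) : R)] * mat w := by
  simp [mat, toE2_cons, Gen.toE2, m]

theorem mat_cons_J (w : List (Gen R)) : mat (.J :: w) = !![0, 1; 1, 0] * mat w := by
  simp [mat, toE2_cons, Gen.toE2, j]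

theorem mat_append (w v : List (Gen R)) : mat (w ++ v) = mat w * mat v := by
  simp [mat, toE2_append]

theorem toE2_inv (g : Gen R) : g.inv.toE2 = g.toE2⁻¹ := by
  apply Subtype.ext
  cases g <;> exact Units.ext (by simp [Gen.inv, Gen.toE2, t, m, j])

theorem toE2_invString (w : List (Gen R)) : toE2 (invString w) = (toE2 w)⁻¹ := by
  induction w with
  | nil => simp [invString, toE2]
  | cons g w ih =>
    have : invString (g :: w) = invString w ++ [g.inv] := by simp [invString]
    rw [this, toE2_append, ih, toE2_cons, toE2_cons, toE2_nil, mul_one, toE2_inv, mul_inv_rev]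

/-! ### The action on columns. -/

/-- A string acts as the fractional linear transformation of its matrix. -/
theorem exists_unit_of_mem_eval {w : List (Gen R)} {x y : R} (h : y ∈ eval w x) :
    ∃ u : Rˣ, mat w 0 0 * x + mat w 0 1 = y * u ∧ mat w 1 0 * x + mat w 1 1 = u := by
  induction w generalizing y with
  | nil =>
    rw [mem_eval_nil] at h
    exact ⟨1, by simp [mat_nil, h], by simp [mat_nil]⟩
  | cons g w ih =>
    obtain ⟨z, hz, hy⟩ := mem_eval_cons.1 h
    obtain ⟨u, h₀, h₁⟩ := ih hz
    cases g with
    | T a =>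
      rw [mem_T] at hy
      refine ⟨u, ?_, by simpa [mat_cons_T, Matrix.mul_apply, Fin.sum_univ_two] using h₁⟩
      simp only [mat_cons_T, Matrix.mul_apply, Fin.sum_univ_two, Matrix.of_apply,
        Matrix.cons_val_zero, Matrix.cons_val_one, Matrix.cons_val', Matrix.cons_val_fin_one]
      rw [hy, add_mul z, ← h₀, ← h₁]
      noncomm_ring
    | M r s =>
      rw [mem_M] at hy
      -- The right factor `s` of the map appears as `s⁻¹` in the second coordinate: `(r z u, s⁻¹ u)
      -- = ((r z s) s⁻¹ u, s⁻¹ u)`.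
      refine ⟨s⁻¹ * u, ?_, ?_⟩
      · simp [mat_cons_M, Matrix.mul_apply, Fin.sum_univ_two, hy, mul_assoc, ← h₀, mul_add]
      · simp [mat_cons_M, Matrix.mul_apply, Fin.sum_univ_two, mul_assoc, ← h₁, mul_add]
    | J =>
      obtain ⟨v, rfl, rfl⟩ := mem_J.1 hy
      -- Swapping the coordinates of `(v u, u)` gives `(u, v u)`, and `u = v⁻¹ (v u)`.
      refine ⟨v * u, ?_, ?_⟩
      · simpa [mat_cons_J, Matrix.mul_apply, Fin.sum_univ_two] using h₁
      · simpa [mat_cons_J, Matrix.mul_apply, Fin.sum_univ_two] using h₀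

/-- The image column of `(x, 1)` is common to both strings: its second entry is the same unit, which
can be cancelled from the first. -/
theorem equivalent_of_mat_eq {w w' : List (Gen R)} (h : mat w = mat w') : Equivalent w w' := by
  refine equivalent_iff.2 fun x y hy y' hy' => ?_
  obtain ⟨u, h₀, h₁⟩ := exists_unit_of_mem_eval hy
  obtain ⟨u', h₀', h₁'⟩ := exists_unit_of_mem_eval hy'
  rw [h] at h₀ h₁
  have hu : u = u' := Units.ext (h₁.symm.trans h₁')
  rw [h₀, hu] at h₀'
  exact (Units.mul_left_inj u').1 h₀'

/-! ### Central scalars. -/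

/-- The inverse of a central unit is central, so units of the centre are the same as central units
of `R`. -/
theorem mem_centralScalars_iff {g : E2 R} : g ∈ centralScalars R ↔
    ∃ z : Rˣ, (∀ x : R, z * x = x * z) ∧
      ((g : (Matrix (Fin 2) (Fin 2) R)ˣ) : Matrix (Fin 2) (Fin 2) R) = !![(z : R), 0; 0, z] := by
  have key (z : R) : Matrix.scalar (Fin 2) z = !![z, 0; 0, z] := by
    ext i k
    fin_cases i <;> fin_cases k <;> simp
  constructor
  · rintro ⟨z, hz⟩
    refine ⟨Units.map (Subring.center R).subtype.toMonoidHom z,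
      fun x => (Subring.mem_center_iff.1 (z : Subring.center R).2 x).symm, ?_⟩
    have hz' : (g : (Matrix (Fin 2) (Fin 2) R)ˣ) = _ := hz.symm
    rw [hz']
    exact key _
  · rintro ⟨z, hz, hg⟩
    have hz' (x : R) : ((z⁻¹ : Rˣ) : R) * x = x * ((z⁻¹ : Rˣ) : R) := by
      rw [Units.inv_mul_eq_iff_eq_mul, ← mul_assoc, hz, mul_assoc, Units.mul_inv, mul_one]
    refine ⟨⟨⟨z, Subring.mem_center_iff.2 fun x => (hz x).symm⟩,
      ⟨((z⁻¹ : Rˣ) : R), Subring.mem_center_iff.2 fun x => (hz' x).symm⟩,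
      Subtype.ext (by simp), Subtype.ext (by simp)⟩, Units.ext ?_⟩
    exact (key _).trans hg.symm

theorem equivalent_nil_of_mem_centralScalars {w : List (Gen R)}
    (h : toE2 w ∈ centralScalars R) : Equivalent w [] := by
  obtain ⟨z, hz, hw⟩ := mem_centralScalars_iff.1 h
  refine equivalent_iff.2 fun x y hy y' hy' => ?_
  rw [mem_eval_nil] at hy'
  obtain ⟨u, h₀, h₁⟩ := exists_unit_of_mem_eval hy
  have hw' : mat w = !![(z : R), 0; 0, z] := hw
  simp only [hw', Matrix.of_apply, Matrix.cons_val_zero, Matrix.cons_val_one, Matrix.cons_val',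
    Matrix.cons_val_fin_one, add_zero, zero_mul, zero_add] at h₀ h₁
  rw [← h₁, hz] at h₀
  rw [hy', (Units.mul_left_inj z).1 h₀]

theorem Equivalent.conj_nil (hR : GroupExists R) {w : List (Gen R)} (h : Equivalent w [])
    (v : List (Gen R)) : Equivalent (FLT.invString v ++ (w ++ v)) [] :=
  ((Equivalent.refl _).append (h.append (Equivalent.refl v))).trans hR
    (equivalent_invString_append v)

/-- Together with `Equivalent.conj_nil`, this allows a string to be replaced by a convenient
conjugate. -/
theorem toE2_conj_mem_iff {w v : List (Gen R)} :
    toE2 (invString v ++ (w ++ v)) ∈ centralScalars R ↔ toE2 w ∈ centralScalars R := by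
  rw [toE2_append, toE2_append, toE2_invString]
  refine ⟨fun h => ?_, fun h => ?_⟩
  · simpa [mul_assoc] using (inferInstance : (centralScalars R).Normal).conj_mem _ h (toE2 v)
  · simpa [mul_assoc] using (inferInstance : (centralScalars R).Normal).conj_mem _ h (toE2 v)⁻¹

/-! ### Strings equivalent to the empty one. -/

/-- An everywhere defined string `x ↦ d x e + c` that is equivalent to the empty one
has a central scalar matrix. -/
theorem toE2_T_M_mem_centralScalars {c : R} {d e : Rˣ}
    (h : Equivalent [Gen.T c, Gen.M d e] []) :
    toE2 [Gen.T c, Gen.M d e] ∈ centralScalars R := by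
  have key (x : R) : d * x * e + c = x :=
    equivalent_iff.1 h x _ (mem_eval_cons.2 ⟨_, mem_eval_cons.2
      ⟨x, mem_eval_nil.2 rfl, mem_M.2 rfl⟩, mem_T.2 rfl⟩) _ (mem_eval_nil.2 rfl)
  -- Evaluation at 0 and at 1 gives `c` and `d`; general `x` then gives `e⁻¹ x e = x`, which is
  -- centrality.
  have hc : c = 0 := by simpa using key 0
  subst hc
  have hde : d = e⁻¹ := eq_inv_of_mul_eq_one_left (Units.ext (by simpa using key 1))
  subst hde
  refine mem_centralScalars_iff.2 ⟨e⁻¹, fun x => ?_, ?_⟩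
  · rw [Units.eq_mul_inv_iff_mul_eq]
    simpa using key x
  · change mat _ = _
    simp [mat_cons_T, mat_cons_M, mat_nil]

/-- Fixing 0 makes the upper right entry vanish and the lower right entry a unit, which puts the
matrix within reach of the affine case. -/
theorem toE2_mem_centralScalars_of_mem_eval_zero (hR : GroupExists R) {w : List (Gen R)}
    (h : Equivalent w []) (h0 : 0 ∈ eval w 0) : toE2 w ∈ centralScalars R := by
  obtain ⟨d, hb, hd⟩ := exists_unit_of_mem_eval h0
  simp only [mul_zero, zero_add, zero_mul] at hb hd
  set A := (toE2 w : (Matrix (Fin 2) (Fin 2) R)ˣ)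
  set B : Matrix (Fin 2) (Fin 2) R := (A⁻¹ : (Matrix (Fin 2) (Fin 2) R)ˣ).val
  have hAB : mat w * B = 1 := A.mul_inv
  have hBA : B * mat w = 1 := A.inv_mul
  have e₁ := congrFun (congrFun hAB 0) 0
  have e₂ := congrFun (congrFun hBA 0) 0
  have e₃ := congrFun (congrFun hBA 0) 1
  simp only [Matrix.mul_apply, Fin.sum_univ_two, hb, hd, zero_mul, mul_zero, add_zero, zero_add,
    Matrix.one_apply_eq, ne_eq, zero_ne_one, not_false_eq_true, Matrix.one_apply_ne,
    Units.mul_left_eq_zero] at e₁ e₂ e₃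
  -- `R` need not be commutative, so both one-sided inverses of the upper left entry are needed; the
  -- left one requires `B 0 1 = 0`, which holds because `d` is a unit.
  rw [e₃, zero_mul, add_zero] at e₂
  let a : Rˣ := ⟨mat w 0 0, B 0 0, e₁, e₂⟩
  have ha : mat w 0 0 = a := rfl
  have hw : mat w = !![(a : R), 0; mat w 1 0, (d : R)] := by
    ext i k
    fin_cases i <;> fin_cases k <;> simp [ha, hb, hd]
  -- The conjugate is upper triangular with diagonal `d, a`; the translation part is the corner
  -- entry divided on the right by `a`.
  have hm : mat (invString [Gen.J] ++ (w ++ [Gen.J])) =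
      mat [Gen.T (mat w 1 0 * ((a⁻¹ : Rˣ) : R)), Gen.M d a⁻¹] := by
    rw [mat_append, mat_append, hw]
    simp [invString, Gen.inv, mat_cons_J, mat_cons_T, mat_cons_M, mat_nil]
  have hJ := h.conj_nil hR [Gen.J]
  have := toE2_T_M_mem_centralScalars ((equivalent_of_mat_eq hm).symm.trans hR hJ)
  rw [← toE2_conj_mem_iff (v := [Gen.J])]
  rwa [show toE2 (invString [Gen.J] ++ (w ++ [Gen.J])) = _ from Subtype.ext (Units.ext hm)]

theorem toE2_mem_centralScalars (hR : GroupExists R) {w : List (Gen R)}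
    (h : Equivalent w []) : toE2 w ∈ centralScalars R := by
  obtain ⟨a, ha, -⟩ := exists_U_subset_dom₃ w [] []
  obtain ⟨x, hx⟩ := hR.nonempty a
  obtain ⟨y, hy⟩ := (PFun.mem_dom _ _).1 (ha hx)
  -- Nonemptiness of the basic domains supplies a point where the string is defined, and equivalence
  -- makes it a fixed point.
  obtain rfl : y = x := equivalent_iff.1 h x y hy x (mem_eval_nil.2 rfl)
  rw [← toE2_conj_mem_iff (v := [Gen.T y])]
  refine toE2_mem_centralScalars_of_mem_eval_zero hR (h.conj_nil hR _) ?_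
  have h0 : y ∈ eval [Gen.T y] (0 : R) :=
    mem_eval_cons.2 ⟨0, mem_eval_nil.2 rfl, mem_T.2 (by simp)⟩
  exact mem_eval_append.2 ⟨y, mem_eval_append.2 ⟨y, h0, hy⟩, mem_eval_invString h0⟩

/-! ### The isomorphism. -/

theorem exists_toE2_eq (g : E2 R) : ∃ w, toE2 w = g := by
  obtain ⟨g, hg⟩ := g
  suffices h : ∃ w : List (Gen R), (toE2 w : (Matrix (Fin 2) (Fin 2) R)ˣ) = g by
    obtain ⟨w, hw⟩ := h
    exact ⟨w, Subtype.ext hw⟩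
  induction hg using Subgroup.closure_induction with
  | mem x hx =>
    obtain (⟨a, rfl⟩ | ⟨⟨r, s⟩, rfl⟩) | rfl := hx
    · exact ⟨[.T a], by simp [toE2, Gen.toE2]⟩
    · exact ⟨[.M r s⁻¹], by simp [toE2, Gen.toE2]⟩
    · exact ⟨[.J], by simp [toE2, Gen.toE2]⟩
  | one => exact ⟨[], rfl⟩
  | mul x y _ _ hx hy =>
    obtain ⟨w, rfl⟩ := hx
    obtain ⟨v, rfl⟩ := hy
    exact ⟨w ++ v, by rw [toE2_append]; rfl⟩
  | inv x _ hx =>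
    obtain ⟨w, rfl⟩ := hx
    exact ⟨invString w, by rw [toE2_invString]; rfl⟩

/-- The homomorphism from the group of fractional linear transformations to `PE(2,R)`. -/
def toPE2 (hR : GroupExists R) : G hR →* PE2 R where
  toFun := Quotient.lift (s := stringSetoid hR) (fun w => (toE2 w : PE2 R)) fun w w' h => by
    refine QuotientGroup.eq.2 ?_
    rw [← toE2_invString, ← toE2_append]
    exact toE2_mem_centralScalars hR
      (((Equivalent.refl _).append (Equivalent.symm h)).trans hR (equivalent_invString_append w))
  map_one' := rfl
  map_mul' := by
    rintro ⟨w⟩ ⟨v⟩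
    exact congrArg (QuotientGroup.mk (s := centralScalars R)) (toE2_append w v)

theorem toPE2_mk (hR : GroupExists R) (w : List (Gen R)) :
    toPE2 hR (G.mk hR w) = (toE2 w : PE2 R) := rfl

theorem toPE2_bijective (hR : GroupExists R) : Function.Bijective (toPE2 hR) := by
  constructor
  · rw [injective_iff_map_eq_one]
    rintro ⟨w⟩ hw
    exact Quotient.sound (s := stringSetoid hR)
      (equivalent_nil_of_mem_centralScalars ((QuotientGroup.eq_one_iff _).1 hw))
  · rintro ⟨g⟩
    obtain ⟨w, rfl⟩ := exists_toE2_eq g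
    exact ⟨G.mk hR w, rfl⟩

end FLT

theorem mainTheorem5 {R : Type*} [Ring R] (hR : FLT.GroupExists R) :
    ∃ φ : FLT.G hR ≃* FLT.PE2 R,
      (∀ a : R, φ (FLT.G.mk hR [FLT.Gen.T a]) = FLT.PE2.mk (FLT.t a) (FLT.t_mem a)) ∧
      (∀ r s : Rˣ, φ (FLT.G.mk hR [FLT.Gen.M r s]) =
        FLT.PE2.mk (FLT.m r s⁻¹) (FLT.m_mem r s⁻¹)) ∧
      φ (FLT.G.mk hR [FLT.Gen.J]) = FLT.PE2.mk FLT.j FLT.j_mem := by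
  have key (g : FLT.Gen R) : FLT.toPE2 hR (FLT.G.mk hR [g]) = (g.toE2 : FLT.PE2 R) := by
    rw [FLT.toPE2_mk, FLT.toE2_cons, FLT.toE2_nil, mul_one]
  exact ⟨MulEquiv.ofBijective (FLT.toPE2 hR) (FLT.toPE2_bijective hR),
    fun a => key (.T a), fun r s => key (.M r s), key .J⟩
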